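/- Let $I=[0,1]$. Let $M\ge 2$ be an integer and let $\Omega=\{\omega_1,\dots,\omega_M\}$ be an LF-inducing set, that is, a set of positive real numbers such that $\omega_1<1<\omega_2$ and, for all integers $k,l$, $\omega_1^k=\omega_2^l$ if and only if $k=l=0$. Put $$F_\Omega=\bigcup_{j=1}^M\{(x,y)\in I^2 : y=\omega_j x\},\qquad I_{F_\Omega}=\{(x_i)_{i\in\mathbb Z}\in I^{\mathbb Z} : (x_i,x_{i+1})\in F_\Omega \text{ for all } i\in\mathbb Z\},$$ where $I_{F_\Omega}$ (the two-sided Mahavier product of $F_\Omega$) has the topology induced by the product topology of $I^{\mathbb Z}$. Then $I_{F_\Omega}$ is a Lelek fan, i.e. a smooth fan whose set of endpoints is dense. Here a continuum is a nonempty compact connected metrizable space; a dendroid is a continuum that is arcwise connected and hereditarily unicoherent (for any two subcontinua $A,B$ whose union is a continuum, $A\cap B$ is connected); an endpoint of a dendroid is a point that is an endpoint of every arc containing it; a ramification point is a common endpoint of three arcs that pairwise meet only in that point; a fan is a dendroid with exactly one ramification point $v$, called its top; and a fan with top $v$ is smooth if $x_n\to x$ implies that the arcs $[v,x_n]$ converge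 to the arc $[v,x]$ in the Hausdorff metric (with $[v,v]=\{v\}$). -/

import Mathlib

open Topology Filter

/-! ### Continua, arcs, dendroids, fans -/

/-- A continuum: a nonempty compact connected metrizable space. -/
structure IsContinuum (X : Type*) [TopologicalSpace X] : Prop where
  compact : CompactSpace X
  connected : ConnectedSpace X
  metrizable : TopologicalSpace.MetrizableSpace X

/-- A subcontinuum of a (metrizable) space: a nonempty compact connected subset
(nonemptiness is part of `IsConnected`). -/
def IsSubcontinuum {X : Type*} [TopologicalSpace X] (K : Set X) : Prop :=
  IsCompact K ∧ IsConnected K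

/-- `A` is an arc with end-points `x` and `y`. -/
def IsArcBetween {X : Type*} [TopologicalSpace X] (A : Set X) (x y : X) : Prop :=
  ∃ φ : unitInterval ≃ₜ A, (φ 0 : X) = x ∧ (φ 1 : X) = y

/-- `A` is an arc: a subset homeomorphic to `[0,1]`. -/
def IsArc {X : Type*} [TopologicalSpace X] (A : Set X) : Prop :=
  Nonempty (unitInterval ≃ₜ A)

/-- `x` is an end-point of the arc `A`. -/
def IsEndpointOfArc {X : Type*} [TopologicalSpace X] (A : Set X) (x : X) : Prop :=
  ∃ φ : unitInterval ≃ₜ A, (φ 0 : X) = x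

/-- Any two distinct points are the end-points of an arc. -/
def IsArcwiseConnected (X : Type*) [TopologicalSpace X] : Prop :=
  ∀ x y : X, x ≠ y → ∃ A : Set X, IsArcBetween A x y

/-- A subcontinuum `K` is unicoherent if, whenever `K` is the union of two subcontinua,
their intersection is connected. -/
def IsUnicoherent {X : Type*} [TopologicalSpace X] (K : Set X) : Prop :=
  ∀ A B : Set X, IsSubcontinuum A → IsSubcontinuum B → A ∪ B = K → IsConnected (A ∩ B)

/-- Every subcontinuum is unicoherent. -/
def IsHereditarilyUnicoherent (X : Type*) [TopologicalSpace X] : Prop :=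
  ∀ K : Set X, IsSubcontinuum K → IsUnicoherent K

/-- A dendroid: an arcwise connected, hereditarily unicoherent continuum. -/
structure IsDendroid (X : Type*) [TopologicalSpace X] : Prop where
  continuum : IsContinuum X
  arcwiseConnected : IsArcwiseConnected X
  hereditarilyUnicoherent : IsHereditarilyUnicoherent X

/-- End-points of a dendroid: the points that are end-points of every arc containing them. -/
def endpointSet (X : Type*) [TopologicalSpace X] : Set X :=
  {x | ∀ A : Set X, IsArc A → x ∈ A → IsEndpointOfArc A x}

/-- `v` is a ramification point: the common end-point of three arcs that pairwise meet
only in `v` (equivalently, the top of a simple triod). -/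
def IsRamificationPoint {X : Type*} [TopologicalSpace X] (v : X) : Prop :=
  ∃ A B C : Set X, IsArc A ∧ IsArc B ∧ IsArc C ∧
    IsEndpointOfArc A v ∧ IsEndpointOfArc B v ∧ IsEndpointOfArc C v ∧
    A ∩ B = {v} ∧ B ∩ C = {v} ∧ A ∩ C = {v}

/-- `X` is a fan with top `v`: a dendroid whose only ramification point is `v`. -/
structure IsFanWithTop (X : Type*) [TopologicalSpace X] (v : X) : Prop where
  dendroid : IsDendroid X
  ramification : ∀ w : X, IsRamificationPoint w ↔ w = v

/-- `A` is the arc from `v` to `x`, where the arc from `v` to `v` is the singleton `{v}`. -/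
def IsArcFromTo {X : Type*} [TopologicalSpace X] (A : Set X) (v x : X) : Prop :=
  (v = x ∧ A = {v}) ∨ IsArcBetween A v x

/-- Smoothness at `v`: if `x n → y`, then the arcs from `v` to `x n` converge to the arc from
`v` to `y`. The topology on the nonempty compact subsets is the Vietoris topology, which is
the topology of the Hausdorff metric for every metric inducing the topology of `X`. -/
def IsSmoothAt (X : Type*) [TopologicalSpace X] (v : X) : Prop :=
  ∀ (x : ℕ → X) (y : X), Tendsto x atTop (𝓝 y) →
    ∀ (A : ℕ → TopologicalSpace.NonemptyCompacts X) (B : TopologicalSpace.NonemptyCompacts X),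
      (∀ n, IsArcFromTo (A n : Set X) v (x n)) → IsArcFromTo (B : Set X) v y →
        Tendsto A atTop (𝓝 B)

/-- A Lelek fan: a smooth fan whose set of end-points is dense. -/
def IsLelekFan (X : Type*) [TopologicalSpace X] : Prop :=
  ∃ v : X, IsFanWithTop X v ∧ IsSmoothAt X v ∧ Dense (endpointSet X)

/-! ### Mahavier products and LF-inducing sets -/

/-- The two-sided Mahavier product of a relation `G` on `X`; as a subset of `ℤ → X` it carries
the topology induced by the product topology. -/
def twoSidedMahavier {X : Type*} (G : Set (X × X)) : Set (ℤ → X) :=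
  {x | ∀ i : ℤ, (x i, x (i + 1)) ∈ G}

/-- `r` and `ρ` never connect. -/
def NeverConnect (r ρ : ℝ) : Prop :=
  0 < r ∧ r < 1 ∧ 1 < ρ ∧ ∀ k l : ℤ, r ^ k = ρ ^ l ↔ k = 0 ∧ l = 0

/-- `Ω = {ω₁, …, ω_M}` with `M ≥ 2` is a set of positive numbers whose first two listed
elements satisfy `ω₁ < 1 < ω₂` and never connect (indices are shifted by one). -/
def IsLFInducing (Ω : Set ℝ) : Prop :=
  ∃ (M : ℕ) (hM : 2 ≤ M) (ω : Fin M → ℝ), Ω = Set.range ω ∧ (∀ i, 0 < ω i) ∧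
    NeverConnect (ω ⟨0, by omega⟩) (ω ⟨1, by omega⟩)

/-- The relation `F_Ω` on `I = [0,1]`: the union of the segments `y = ω x`, `ω ∈ Ω`. -/
def lineRelation (Ω : Set ℝ) : Set (unitInterval × unitInterval) :=
  ⋃ ω ∈ Ω, {p | (p.2 : ℝ) = ω * (p.1 : ℝ)}

/-! ### Arcs -/

section Arcs

variable {X : Type*} [TopologicalSpace X] {A : Set X} {x y : X}

/-! The relation is a union of lines through the origin, so `[0,1]` acts on the product by
coordinatewise scaling. All slopes are positive, so a nonzero point has only positive coordinates
and is determined by one coordinate together with its ratios of successive coordinates. The space is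
thus a union of rays from the zero sequence, and two rays either are nested or meet only there.

`IsStarAction` isolates what makes such a space a smooth fan once there are three independent rays.
Its topological content is `cut`: a closed connected set cannot leave a ray except downwards through
its points. This holds here (`mem_of_isPreconnected`) because `Ω` is finite, so each ratio is
locally constant away from zero. Smoothness comes from continuity of the action.

A nonzero point that is maximal on its ray is an endpoint, and supremum `1` of the coordinates
forces maximality. Density therefore reduces to changing a nonzero point far to the right so that
its supremum becomes `1`. In logarithmic scale this is a walk on `(-∞, 0]` with steps `log a < 0 <
log b`. Modulo `log b - log a` both steps are the same rotation, which is irrational since `a` and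
`b` never connect; its dense orbit brings the walk arbitrarily close to `0`
(`exists_lt_greedyWalk`). -/

theorem isArcBetween_range [T2Space X] {γ : unitInterval → X} (hγ : Continuous γ)
    (hinj : Function.Injective γ) : IsArcBetween (Set.range γ) (γ 0) (γ 1) :=
  ⟨(hγ.isClosedEmbedding hinj).isEmbedding.toHomeomorph, rfl, rfl⟩

theorem IsArcBetween.symm (h : IsArcBetween A x y) : IsArcBetween A y x := by
  obtain ⟨φ, h0, h1⟩ := h
  exact ⟨unitInterval.symmHomeomorph.trans φ, by simpa using h1, by simpa using h0⟩

theorem IsArcBetween.isArc (h : IsArcBetween A x y) : IsArc A :=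
  ⟨h.choose⟩

theorem IsArcBetween.isEndpointOfArc (h : IsArcBetween A x y) : IsEndpointOfArc A x :=
  ⟨h.choose, h.choose_spec.1⟩

theorem IsArc.isCompact (h : IsArc A) : IsCompact A := by
  obtain ⟨φ⟩ := h
  exact isCompact_iff_compactSpace.2 φ.compactSpace

theorem IsArc.isPreconnected (h : IsArc A) : IsPreconnected A := by
  obtain ⟨φ⟩ := h
  have : A = Set.range fun t => (φ t : X) := by
    ext z
    refine ⟨fun hz => ⟨φ.symm ⟨z, hz⟩, by simp⟩, ?_⟩
    rintro ⟨t, rfl⟩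
    exact (φ t).2
  rw [this]
  exact isPreconnected_range (by fun_prop)

theorem IsArc.exists_ne (h : IsArc A) (w : X) : ∃ a ∈ A, a ≠ w := by
  obtain ⟨φ⟩ := h
  by_contra! H
  have : φ 0 = φ 1 := Subtype.ext ((H _ (φ 0).2).trans (H _ (φ 1).2).symm)
  exact zero_ne_one (φ.injective this)

theorem IsEndpointOfArc.mem (h : IsEndpointOfArc A x) : x ∈ A := by
  obtain ⟨φ, rfl⟩ := h
  exact (φ 0).2

end Arcs

/-! ### Star-shaped actions of the unit interval -/

/-- The ray `{t • x : t ∈ [0,1]}` joining `0 • x` to `x`. -/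
def ray {X : Type*} [MulAction unitInterval X] (x : X) : Set X :=
  Set.range fun t : unitInterval => t • x

/-- An action of the multiplicative monoid `[0,1]` that contracts the space to `v` along arcs
which meet only in `v` unless one contains the other, and such that a closed connected set with
two points `x` and `y` contains all points of the ray of `x` outside the ray of `y`. -/
structure IsStarAction (X : Type*) [TopologicalSpace X] [MulAction unitInterval X] (v : X) :
    Prop where
  zero_smul : ∀ x : X, (0 : unitInterval) • x = v
  smul_inj : ∀ (x : X) (s t : unitInterval), x ≠ v → s • x = t • x → s = t
  comparable : ∀ (x y z : X), z ∈ ray x → z ∈ ray y → z ≠ v → x ∈ ray y ∨ y ∈ ray x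
  cut : ∀ K : Set X, IsClosed K → IsPreconnected K →
    ∀ x ∈ K, ∀ y ∈ K, ∀ z ∈ ray x, z ∉ ray y → z ∈ K

section Ray

variable {X : Type*} [MulAction unitInterval X]

theorem smul_mem_ray (t : unitInterval) (x : X) : t • x ∈ ray x := ⟨t, rfl⟩

theorem self_mem_ray (x : X) : x ∈ ray x := ⟨1, one_smul _ x⟩

theorem isPreconnected_ray [TopologicalSpace X] [ContinuousSMul unitInterval X] (x : X) :
    IsPreconnected (ray x) :=
  isPreconnected_range (by fun_prop)

end Ray

namespace IsStarAction

variable {X : Type*} [TopologicalSpace X] [MulAction unitInterval X] {v : X}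

theorem smul_base (h : IsStarAction X v) (t : unitInterval) : t • v = v := by
  rw [← h.zero_smul v, ← mul_smul, mul_zero]

theorem base_mem_ray (h : IsStarAction X v) (x : X) : v ∈ ray x := ⟨0, h.zero_smul x⟩

theorem ray_base (h : IsStarAction X v) : ray v = {v} := by
  ext z
  constructor
  · rintro ⟨t, rfl⟩
    exact h.smul_base t
  · rintro rfl
    exact self_mem_ray z

theorem smul_ne (h : IsStarAction X v) {x : X} (hx : x ≠ v) {t : unitInterval} (ht : t ≠ 0) :
    t • x ≠ v := fun H =>
  ht (h.smul_inj x t 0 hx (H.trans (h.zero_smul x).symm))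

theorem ray_antisymm (h : IsStarAction X v) {x y : X} (hxy : x ∈ ray y) (hyx : y ∈ ray x) :
    x = y := by
  by_cases hy : y = v
  · subst hy
    rwa [h.ray_base] at hxy
  obtain ⟨t, rfl⟩ := hxy
  obtain ⟨s, hs⟩ := hyx
  have h1 : s * t = 1 := h.smul_inj y _ _ hy (by rw [mul_smul, one_smul]; exact hs)
  have ht : t = 1 := le_antisymm le_top (h1 ▸ unitInterval.mul_le_right)
  simp [ht]

variable [ContinuousSMul unitInterval X]

theorem isArcBetween_ray [T2Space X] (h : IsStarAction X v) {x : X} (hx : x ≠ v) :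
    IsArcBetween (ray x) v x := by
  have := isArcBetween_range (γ := fun t : unitInterval => t • x) (by fun_prop)
    fun s t hst => h.smul_inj x s t hx hst
  rw [h.zero_smul, one_smul] at this
  exact this

theorem preconnectedSpace (h : IsStarAction X v) : PreconnectedSpace X :=
  ⟨isPreconnected_of_forall v fun x _ =>
    ⟨ray x, Set.subset_univ _, h.base_mem_ray x, self_mem_ray x, isPreconnected_ray x⟩⟩

/-! ### Connected sets and hereditary unicoherence -/

/-- By comparability `t • x` is off the ray of `y` for `t > 0`, so `cut` applies; closedness adds `t
= 0`. -/
theorem ray_subset_of_incomparable (h : IsStarAction X v) {K : Set X} (hK : IsClosed K)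
    (hc : IsPreconnected K) {x y : X} (hx : x ∈ K) (hy : y ∈ K) (hxy : x ∉ ray y)
    (hyx : y ∉ ray x) : ray x ⊆ K := by
  have hxv : x ≠ v := fun e => hxy (e ▸ h.base_mem_ray y)
  have hcl : IsClosed {t : unitInterval | t • x ∈ K} := hK.preimage (by fun_prop)
  have hpos : Set.Ioi (0 : unitInterval) ⊆ {t : unitInterval | t • x ∈ K} := fun t ht =>
    h.cut K hK hc x hx y hy _ (smul_mem_ray t x) fun hty =>
      (h.comparable x y _ (smul_mem_ray t x) hty (h.smul_ne hxv (ne_of_gt ht))).elim hxy hyx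
  have := closure_minimal hpos hcl
  rw [closure_Ioi' ⟨1, zero_lt_one⟩] at this
  rintro _ ⟨t, rfl⟩
  exact this (Set.mem_Ici.2 bot_le)

omit [ContinuousSMul unitInterval X] in
theorem ray_subset_of_base_mem (h : IsStarAction X v) {K : Set X} (hK : IsClosed K)
    (hc : IsPreconnected K) {x : X} (hx : x ∈ K) (hv : v ∈ K) : ray x ⊆ K := by
  intro z hz
  by_cases hzv : z = v
  · rwa [hzv]
  · exact h.cut K hK hc x hx v hv z hz (by rwa [h.ray_base])

theorem exists_isPreconnected_hull_of_mem (h : IsStarAction X v) {x y : X} (hyx : y ∈ ray x) :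
    ∃ C : Set X, IsPreconnected C ∧ x ∈ C ∧ y ∈ C ∧
      ∀ K : Set X, IsClosed K → IsPreconnected K → x ∈ K → y ∈ K → C ⊆ K := by
  obtain ⟨r, rfl⟩ := hyx
  refine ⟨(fun t : unitInterval => t • x) '' Set.Icc r 1, ?_, ?_, ?_, ?_⟩
  · exact isPreconnected_Icc.image _ (by fun_prop)
  · exact ⟨1, ⟨le_top, le_rfl⟩, one_smul _ x⟩
  · exact ⟨r, ⟨le_rfl, le_top⟩, rfl⟩
  · rintro K hK hc hx hy _ ⟨t, ⟨hrt, -⟩, rfl⟩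
    -- The cut property fails to apply only if `t • x` is on the ray of `r • x`; as `r ≤ t`, the two
    -- points then coincide.
    by_cases htr : t • x ∈ ray (r • x)
    · have hrt' : r • x ∈ ray (t • x) := by
        obtain rfl | ht := eq_or_ne t 0
        · have : r = 0 := le_antisymm hrt bot_le
          rw [this]
          exact self_mem_ray _
        · have htp : (0 : ℝ) < t := lt_of_le_of_ne t.2.1 fun e => ht (Subtype.ext e.symm)
          refine ⟨⟨(r : ℝ) / t, div_nonneg r.2.1 htp.le, (div_le_one htp).2 hrt⟩, ?_⟩
          change _ • t • x = _
          rw [← mul_smul]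
          congr 1
          exact Subtype.ext (div_mul_cancel₀ _ htp.ne')
      change t • x ∈ K
      rw [h.ray_antisymm htr hrt']
      exact hy
    · exact h.cut K hK hc x hx _ hy _ (smul_mem_ray t x) htr

/-- Any two points lie in a connected set which is contained in every closed connected set
containing both of them. -/
theorem exists_isPreconnected_hull (h : IsStarAction X v) (x y : X) :
    ∃ C : Set X, IsPreconnected C ∧ x ∈ C ∧ y ∈ C ∧
      ∀ K : Set X, IsClosed K → IsPreconnected K → x ∈ K → y ∈ K → C ⊆ K := by
  by_cases hyx : y ∈ ray x
  · exact h.exists_isPreconnected_hull_of_mem hyx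
  by_cases hxy : x ∈ ray y
  · obtain ⟨C, h1, h2, h3, h4⟩ := h.exists_isPreconnected_hull_of_mem hxy
    exact ⟨C, h1, h3, h2, fun K hK hc hx hy => h4 K hK hc hy hx⟩
  · refine ⟨ray x ∪ ray y, ?_, .inl (self_mem_ray x), .inr (self_mem_ray y), ?_⟩
    · exact (isPreconnected_ray x).union v (h.base_mem_ray x) (h.base_mem_ray y)
        (isPreconnected_ray y)
    · exact fun K hK hc hx hy => Set.union_subset
        (h.ray_subset_of_incomparable hK hc hx hy hxy hyx)
        (h.ray_subset_of_incomparable hK hc hy hx hyx hxy)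

/-- The connected hull of two points of `A ∩ B` lies in both `A` and `B`. -/
theorem isHereditarilyUnicoherent [T2Space X] (h : IsStarAction X v) :
    IsHereditarilyUnicoherent X := by
  rintro K ⟨-, hK⟩ A B ⟨hA, hAc⟩ ⟨hB, hBc⟩ rfl
  constructor
  · obtain ⟨a, ha⟩ := hAc.nonempty
    obtain ⟨b, hb⟩ := hBc.nonempty
    obtain ⟨z, -, hz⟩ := isPreconnected_closed_iff.1 hK.isPreconnected A B hA.isClosed hB.isClosed
      subset_rfl ⟨a, .inl ha, ha⟩ ⟨b, .inr hb, hb⟩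
    exact ⟨z, hz⟩
  · refine isPreconnected_of_forall_pair fun x hx y hy => ?_
    obtain ⟨C, h1, h2, h3, h4⟩ := h.exists_isPreconnected_hull x y
    exact ⟨C, Set.subset_inter (h4 A hA.isClosed hAc.isPreconnected hx.1 hy.1)
      (h4 B hB.isClosed hBc.isPreconnected hx.2 hy.2), h2, h3, h1⟩

/-! ### Arcwise connectedness -/

theorem exists_isArcBetween_of_mem [T2Space X] (h : IsStarAction X v) {x y : X} (hyx : y ∈ ray x)
    (hne : x ≠ y) : ∃ A, IsArcBetween A y x := by
  have hxv : x ≠ v := by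
    rintro rfl
    rw [h.ray_base] at hyx
    exact hne hyx.symm
  obtain ⟨r, rfl⟩ := hyx
  have hr : unitInterval.symm r ≠ 0 := fun e => hne (by
    have : r = 1 := by simpa using e
    simp [this])
  have hr' : ((unitInterval.symm r : unitInterval) : ℝ) ≠ 0 := fun e => hr (Subtype.ext e)
  have := isArcBetween_range
    -- The scalar is `1 - (1 - s)(1 - r)`, the affine path from `r` to `1`.
    (γ := fun s => unitInterval.symm (unitInterval.symm s * unitInterval.symm r) • x)
    (by fun_prop) fun s t hst => by
      have h1 := unitInterval.symm_bijective.injective (h.smul_inj x _ _ hxv hst)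
      have h2 : ((unitInterval.symm s : unitInterval) : ℝ) * unitInterval.symm r
        = unitInterval.symm t * unitInterval.symm r := congrArg Subtype.val h1
      exact unitInterval.symm_bijective.injective (Subtype.ext (mul_right_cancel₀ hr' h2))
  exact ⟨_, by simpa using this⟩

theorem exists_isArcBetween_of_incomparable [T2Space X] (h : IsStarAction X v) {x y : X}
    (hxy : x ∉ ray y) (hyx : y ∉ ray x) : ∃ A, IsArcBetween A x y := by
  have hxv : x ≠ v := fun e => hxy (e ▸ h.base_mem_ray y)
  have hyv : y ≠ v := fun e => hyx (e ▸ h.base_mem_ray x)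
  -- The arc descends the ray of `x` to `v` in the first half and climbs the ray of `y` in the
  -- second; the clamping is inactive on the half where each scalar is used.
  let a : unitInterval → unitInterval := fun s => Set.projIcc 0 1 zero_le_one (1 - 2 * (s : ℝ))
  let b : unitInterval → unitInterval := fun s => Set.projIcc 0 1 zero_le_one (2 * (s : ℝ) - 1)
  have ha : ∀ s : unitInterval, (s : ℝ) ≤ 1 / 2 → (a s : ℝ) = 1 - 2 * s := fun s hs => by
    simp only [a]
    rw [Set.projIcc_of_mem zero_le_one (x := 1 - 2 * (s : ℝ))
      ⟨by linarith, by linarith [s.2.1]⟩]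
  have hb : ∀ s : unitInterval, 1 / 2 ≤ (s : ℝ) → (b s : ℝ) = 2 * s - 1 := fun s hs => by
    simp only [b]
    rw [Set.projIcc_of_mem zero_le_one (x := 2 * (s : ℝ) - 1)
      ⟨by linarith, by linarith [s.2.2]⟩]
  let γ : unitInterval → X := fun s => if (s : ℝ) ≤ 1 / 2 then a s • x else b s • y
  have hac : Continuous a := continuous_projIcc.comp (by fun_prop)
  have hbc : Continuous b := continuous_projIcc.comp (by fun_prop)
  have hγ : Continuous γ := by
    refine Continuous.if_le (by fun_prop) (by fun_prop) (by fun_prop) (by fun_prop) ?_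
    intro s hs
    have h1 : a s = 0 := Subtype.ext (by rw [ha s hs.le, hs]; norm_num)
    have h2 : b s = 0 := Subtype.ext (by rw [hb s hs.ge, hs]; norm_num)
    rw [h1, h2, h.zero_smul, h.zero_smul]
  have hcross : ∀ s t : unitInterval, ¬ (t : ℝ) ≤ 1 / 2 → a s • x ≠ b t • y := by
    intro s t ht e
    have hbt : b t ≠ 0 := fun e0 => by
      have := hb t (not_le.1 ht).le
      rw [e0] at this
      have h0 : (((0 : unitInterval)) : ℝ) = 0 := rfl
      linarith
    exact (h.comparable x y _ (e ▸ smul_mem_ray _ x) (smul_mem_ray (b t) y)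
      (h.smul_ne hyv hbt)).elim hxy hyx
  have hinj : Function.Injective γ := by
    intro s t hst
    simp only [γ] at hst
    split_ifs at hst with hs ht ht
    · have := congrArg Subtype.val (h.smul_inj x _ _ hxv hst)
      rw [ha s hs, ha t ht] at this
      exact Subtype.ext (by linarith)
    · exact absurd hst (hcross s t ht)
    · exact absurd hst.symm (hcross t s hs)
    · have := congrArg Subtype.val (h.smul_inj y _ _ hyv hst)
      rw [hb s (not_le.1 hs).le, hb t (not_le.1 ht).le] at this
      exact Subtype.ext (by linarith)
  have h0 : γ 0 = x := by
    have : a 0 = 1 := Subtype.ext (by rw [ha 0 (by norm_num)]; norm_num)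
    simp [γ, this]
  have h1 : γ 1 = y := by
    have : b 1 = 1 := Subtype.ext (by rw [hb 1 (by norm_num)]; norm_num)
    have h12 : ¬ ((1 : unitInterval) : ℝ) ≤ 1 / 2 := by norm_num
    simp only [γ, if_neg h12, this, one_smul]
  have := isArcBetween_range hγ hinj
  rw [h0, h1] at this
  exact ⟨_, this⟩

theorem isArcwiseConnected [T2Space X] (h : IsStarAction X v) : IsArcwiseConnected X := by
  intro x y hne
  by_cases hyx : y ∈ ray x
  · obtain ⟨A, hA⟩ := h.exists_isArcBetween_of_mem hyx hne
    exact ⟨A, hA.symm⟩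
  by_cases hxy : x ∈ ray y
  · exact h.exists_isArcBetween_of_mem hxy hne.symm
  · exact h.exists_isArcBetween_of_incomparable hxy hyx

theorem isDendroid [CompactSpace X] [TopologicalSpace.MetrizableSpace X] (h : IsStarAction X v) :
    IsDendroid X where
  continuum :=
    { compact := inferInstance
      connected := { h.preconnectedSpace with toNonempty := ⟨v⟩ }
      metrizable := inferInstance }
  arcwiseConnected := h.isArcwiseConnected
  hereditarilyUnicoherent := h.isHereditarilyUnicoherent

/-! ### Ramification points -/

omit [ContinuousSMul unitInterval X] in
/-- A closed connected set containing `w ≠ v` and another point contains a point above `w` or a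
segment immediately below `w`. -/
theorem mem_ray_or_exists_smul_mem (h : IsStarAction X v) {K : Set X} (hK : IsClosed K)
    (hc : IsPreconnected K) {w a : X} (hw : w ∈ K) (ha : a ∈ K) (hne : a ≠ w) (hwv : w ≠ v) :
    w ∈ ray a ∨ ∃ r : unitInterval, r < 1 ∧ ∀ t, r ≤ t → t • w ∈ K := by
  by_cases hwa : w ∈ ray a
  · exact .inl hwa
  refine .inr ?_
  by_cases haw : a ∈ ray w
  · obtain ⟨r, rfl⟩ := haw
    refine ⟨r, lt_of_le_of_ne le_top fun e => hne (by simp [e]), fun t hrt => ?_⟩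
    by_cases ht : t • w ∈ ray (r • w)
    · obtain ⟨s, hs⟩ := ht
      have h1 : s * r = t := h.smul_inj w _ _ hwv (by rw [mul_smul]; exact hs)
      have h2 : t = r := le_antisymm (h1 ▸ unitInterval.mul_le_right) hrt
      rw [h2]
      exact ha
    · exact h.cut K hK hc w hw _ ha _ (smul_mem_ray t w) ht
  -- Any scalar strictly between `0` and `1` would do: only `t ≠ 0` is needed.
  · refine ⟨⟨1 / 2, by norm_num, by norm_num⟩, ?_, fun t ht => ?_⟩
    · exact Subtype.mk_lt_mk.2 (by norm_num)
    · have ht0 : t ≠ 0 := by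
        rintro rfl
        have : (1 / 2 : ℝ) ≤ 0 := ht
        norm_num at this
      exact h.cut K hK hc w hw a ha _ (smul_mem_ray t w) fun hta =>
        (h.comparable w a _ (smul_mem_ray t w) hta (h.smul_ne hwv ht0)).elim hwa haw

omit [ContinuousSMul unitInterval X] in
theorem inter_ne_singleton_of_below (h : IsStarAction X v) {A B : Set X} {w : X} (hwv : w ≠ v)
    (hA : ∃ r : unitInterval, r < 1 ∧ ∀ t, r ≤ t → t • w ∈ A)
    (hB : ∃ r : unitInterval, r < 1 ∧ ∀ t, r ≤ t → t • w ∈ B) : A ∩ B ≠ {w} := by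
  obtain ⟨r, hr, hA⟩ := hA
  obtain ⟨s, hs, hB⟩ := hB
  intro e
  have h1 : (r ⊔ s) • w ∈ A ∩ B := ⟨hA _ le_sup_left, hB _ le_sup_right⟩
  rw [e] at h1
  have h2 : r ⊔ s = 1 := h.smul_inj w _ _ hwv (by rw [one_smul]; exact h1)
  exact (sup_lt_iff.2 ⟨hr, hs⟩).ne h2

omit [ContinuousSMul unitInterval X] in
-- The points `a` and `b` above `w` are comparable, and the lower one lies between `w` and the
-- other, so `cut` puts it in both sets.
theorem inter_ne_singleton_of_above (h : IsStarAction X v) {A B : Set X} (hA : IsClosed A)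
    (hAc : IsPreconnected A) (hB : IsClosed B) (hBc : IsPreconnected B) {w a b : X} (hwv : w ≠ v)
    (hwA : w ∈ A) (hwB : w ∈ B) (ha : a ∈ A) (hb : b ∈ B) (haw : a ≠ w) (hbw : b ≠ w)
    (hwa : w ∈ ray a) (hwb : w ∈ ray b) : A ∩ B ≠ {w} := by
  intro e
  have key : ∀ A B : Set X, IsClosed A → IsPreconnected A → w ∈ A → A ∩ B = {w} →
      ∀ a ∈ A, ∀ b ∈ B, b ≠ w → w ∈ ray b → b ∉ ray a := by
    intro A B hA hAc hwA e a ha b hb hbw hwb hba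
    have : b ∈ A := h.cut A hA hAc a ha w hwA b hba fun hbw' => hbw (h.ray_antisymm hbw' hwb)
    exact hbw (e.subset ⟨this, hb⟩)
  exact (h.comparable a b w hwa hwb hwv).elim
    (key B A hB hBc hwB (by rwa [Set.inter_comm]) b hb a ha haw hwa)
    (key A B hA hAc hwA e a ha b hb hbw hwb)

omit [ContinuousSMul unitInterval X] in
-- Away from `v` there are only two directions, up and down. Two of the three arcs share one of them
-- and so meet outside `w`.
theorem not_isRamificationPoint [T2Space X] (h : IsStarAction X v) {w : X} (hwv : w ≠ v) :
    ¬ IsRamificationPoint w := by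
  rintro ⟨A, B, C, hA, hB, hC, hwA, hwB, hwC, hAB, hBC, hAC⟩
  have dich : ∀ A : Set X, IsArc A → w ∈ A → (∃ a ∈ A, a ≠ w ∧ w ∈ ray a) ∨
      ∃ r : unitInterval, r < 1 ∧ ∀ t, r ≤ t → t • w ∈ A := fun A hA hw => by
    obtain ⟨a, ha, hne⟩ := hA.exists_ne w
    refine (h.mem_ray_or_exists_smul_mem hA.isCompact.isClosed hA.isPreconnected hw ha hne
      hwv).imp_left fun h1 => ⟨a, ha, hne, h1⟩
  have above : ∀ A B : Set X, IsArc A → IsArc B → w ∈ A → w ∈ B → A ∩ B = {w} →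
      (∃ a ∈ A, a ≠ w ∧ w ∈ ray a) → (∃ a ∈ B, a ≠ w ∧ w ∈ ray a) → False := by
    rintro A B hA hB hwA hwB e ⟨a, ha, h1, h2⟩ ⟨b, hb, h3, h4⟩
    exact h.inter_ne_singleton_of_above hA.isCompact.isClosed hA.isPreconnected
      hB.isCompact.isClosed hB.isPreconnected hwv hwA hwB ha hb h1 h3 h2 h4 e
  rcases dich A hA hwA.mem with uA | dA <;> rcases dich B hB hwB.mem with uB | dB
  · exact above A B hA hB hwA.mem hwB.mem hAB uA uB
  · rcases dich C hC hwC.mem with uC | dC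
    · exact above A C hA hC hwA.mem hwC.mem hAC uA uC
    · exact h.inter_ne_singleton_of_below hwv dB dC hBC
  · rcases dich C hC hwC.mem with uC | dC
    · exact above B C hB hC hwB.mem hwC.mem hBC uB uC
    · exact h.inter_ne_singleton_of_below hwv dA dC hAC
  · exact h.inter_ne_singleton_of_below hwv dA dB hAB

theorem isRamificationPoint_base [T2Space X] (h : IsStarAction X v) {x y z : X}
    (hxy : ray x ∩ ray y = {v}) (hyz : ray y ∩ ray z = {v}) (hxz : ray x ∩ ray z = {v})
    (hx : x ≠ v) (hy : y ≠ v) (hz : z ≠ v) : IsRamificationPoint v :=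
  ⟨ray x, ray y, ray z, (h.isArcBetween_ray hx).isArc, (h.isArcBetween_ray hy).isArc,
    (h.isArcBetween_ray hz).isArc, (h.isArcBetween_ray hx).isEndpointOfArc,
    (h.isArcBetween_ray hy).isEndpointOfArc, (h.isArcBetween_ray hz).isEndpointOfArc,
    hxy, hyz, hxz⟩

/-! ### Smoothness and endpoints -/

theorem eq_ray_of_isArcFromTo [T2Space X] (h : IsStarAction X v) {A : Set X} {x : X}
    (hA : IsArcFromTo A v x) : A = ray x := by
  obtain ⟨rfl, rfl⟩ | hA := hA
  · exact h.ray_base.symm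
  have hsub : ray x ⊆ A := by
    refine h.ray_subset_of_base_mem hA.isArc.isCompact.isClosed hA.isArc.isPreconnected
      hA.symm.isEndpointOfArc.mem hA.isEndpointOfArc.mem
  refine subset_antisymm ?_ hsub
  obtain ⟨φ, h0, h1⟩ := hA
  have hind : IsInducing fun t => (φ t : X) := IsInducing.subtypeVal.comp φ.isInducing
  -- A connected set of parameters containing `0` and `1` is all of `[0,1]`.
  have hS : IsPreconnected ((fun t => (φ t : X)) ⁻¹' ray x) := by
    rw [← hind.isPreconnected_image, Set.image_preimage_eq_of_subset]
    · exact isPreconnected_ray x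
    · intro z hz
      exact ⟨φ.symm ⟨z, hsub hz⟩, by simp⟩
  have hmem := hS.Icc_subset (a := 0) (b := 1) (by simpa [h0] using h.base_mem_ray x)
    (by simpa [h1] using self_mem_ray x)
  intro z hz
  have : (φ (φ.symm ⟨z, hz⟩) : X) ∈ ray x := hmem ⟨bot_le, le_top⟩
  simpa using this

/-- The arc from `v` to `z` must be `ray z`, the image of `[0,1]` under a map depending continuously
on `z`. -/
theorem isSmoothAt [T2Space X] (h : IsStarAction X v) : IsSmoothAt X v := by
  intro x y hxy A B hA hB
  let R : X → TopologicalSpace.NonemptyCompacts X := fun z =>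
    (⊤ : TopologicalSpace.NonemptyCompacts unitInterval).map (fun t => t • z) (by fun_prop)
  have hR : Continuous R :=
    Continuous.nonemptyCompacts_map' (g := fun (z : X) (t : unitInterval) => t • z)
      continuous_const (by simp only [Function.uncurry_def]; fun_prop)
  have hRray : ∀ z, (R z : Set X) = ray z := fun z => by
    simp [R, ray, Set.image_univ]
  have hAR : A = fun n => R (x n) := funext fun n => SetLike.coe_injective (by
    rw [hRray]
    exact h.eq_ray_of_isArcFromTo (hA n))
  have hBR : B = R y := SetLike.coe_injective (by
    rw [hRray]
    exact h.eq_ray_of_isArcFromTo hB)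
  rw [hAR, hBR]
  exact (hR.tendsto y).comp hxy

omit [ContinuousSMul unitInterval X] in
-- If `x` were interior to an arc, both halves of the arc would have to leave `x` downwards, since
-- nothing is above it, and would overlap.
theorem mem_endpointSet [T2Space X] (h : IsStarAction X v) {x : X} (hx : x ≠ v)
    (hmax : ∀ y, x ∈ ray y → y = x) : x ∈ endpointSet X := by
  rintro A ⟨φ⟩ hxA
  obtain ⟨c, hc⟩ := φ.surjective ⟨x, hxA⟩
  by_cases hc0 : c = 0
  · exact ⟨φ, by rw [← hc0, hc]⟩
  by_cases hc1 : c = 1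
  · exact ⟨unitInterval.symmHomeomorph.trans φ, by simp [← hc1, hc]⟩
  exfalso
  have hcont : Continuous fun t => (φ t : X) := by fun_prop
  have hinj : Function.Injective fun t => (φ t : X) :=
    Subtype.val_injective.comp φ.injective
  have hcx : (φ c : X) = x := by rw [hc]
  have below : ∀ a b d : unitInterval, c ∈ Set.Icc a b → d ∈ Set.Icc a b → d ≠ c →
      ∃ r : unitInterval, r < 1 ∧ ∀ t, r ≤ t → t • x ∈ (fun t => (φ t : X)) '' Set.Icc a b := by
    intro a b d hcm hdm hdc
    have hne : (φ d : X) ≠ x := fun e => hdc (hinj (e.trans hcx.symm))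
    refine (h.mem_ray_or_exists_smul_mem (isCompact_Icc.image hcont).isClosed
      (isPreconnected_Icc.image _ hcont.continuousOn) ⟨c, hcm, hcx⟩ ⟨d, hdm, rfl⟩ hne
      hx).resolve_left fun h1 => hne (hmax _ h1)
  refine h.inter_ne_singleton_of_below hx
    (below 0 c 0 ⟨bot_le, le_rfl⟩ ⟨le_rfl, bot_le⟩ (Ne.symm hc0))
    (below c 1 1 ⟨le_rfl, le_top⟩ ⟨le_top, le_rfl⟩ (Ne.symm hc1)) ?_
  rw [← Set.image_inter hinj]
  have : Set.Icc 0 c ∩ Set.Icc c 1 = {c} := Set.Icc_inter_Icc_eq_singleton bot_le le_top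
  rw [this, Set.image_singleton, hcx]

theorem isLelekFan [CompactSpace X] [TopologicalSpace.MetrizableSpace X] (h : IsStarAction X v)
    {x y z : X} (hxy : ray x ∩ ray y = {v}) (hyz : ray y ∩ ray z = {v})
    (hxz : ray x ∩ ray z = {v}) (hx : x ≠ v) (hy : y ≠ v) (hz : z ≠ v)
    (hdense : Dense {x : X | x ≠ v ∧ ∀ y, x ∈ ray y → y = x}) : IsLelekFan X := by
  refine ⟨v, ⟨h.isDendroid, fun w => ⟨fun hw => ?_, ?_⟩⟩, h.isSmoothAt,
    hdense.mono fun x hx => h.mem_endpointSet hx.1 hx.2⟩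
  · by_contra hwv
    exact h.not_isRamificationPoint hwv hw
  · rintro rfl
    exact h.isRamificationPoint_base hxy hyz hxz hx hy hz

end IsStarAction

/-! ### Greedy multiplicative walks -/

section GreedyWalk

/-- The walk on `(-∞, 0]` which goes up by `β` whenever this is possible and else down by `α`. -/
noncomputable def greedyWalk (α β u : ℝ) : ℕ → ℝ
  | 0 => u
  | n + 1 => if greedyWalk α β u n + β ≤ 0 then greedyWalk α β u n + β else greedyWalk α β u n - α

variable {α β u : ℝ}

theorem greedyWalk_succ_eq (n : ℕ) :
    greedyWalk α β u (n + 1) = greedyWalk α β u n - α ∨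
      greedyWalk α β u (n + 1) = greedyWalk α β u n + β := by
  rw [greedyWalk]
  split_ifs
  · exact .inr rfl
  · exact .inl rfl

theorem greedyWalk_nonpos (hα : 0 < α) (hu : u ≤ 0) (n : ℕ) : greedyWalk α β u n ≤ 0 := by
  induction n with
  | zero => exact hu
  | succ n ih =>
    rw [greedyWalk]
    split_ifs with h
    · exact h
    · linarith

/-- While the walk is at most `-β` it climbs by `β`, so it eventually exceeds `-β`. It steps down
only from above `-β`, hence never again reaches `-(α + β)`. -/
theorem exists_forall_ge_lt_greedyWalk (hα : 0 < α) (hβ : 0 < β) :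
    ∃ N, ∀ n, -(α + β) < greedyWalk α β u (N + n) := by
  obtain ⟨N, hN⟩ : ∃ N, -β < greedyWalk α β u N := by
    by_contra! H
    have hlin : ∀ n : ℕ, greedyWalk α β u n = u + n * β := by
      intro n
      induction n with
      | zero => simp [greedyWalk]
      | succ n ih =>
        rw [greedyWalk, if_pos (by linarith [H n]), ih]
        push_cast
        ring
    obtain ⟨n, hn⟩ := exists_nat_gt (-u / β)
    have h1 := H n
    rw [hlin] at h1
    rw [div_lt_iff₀ hβ] at hn
    linarith
  refine ⟨N, fun n => ?_⟩
  induction n with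
  | zero =>
    rw [Nat.add_zero]
    linarith
  | succ n ih =>
    rw [← Nat.add_assoc, greedyWalk]
    split_ifs with h
    · linarith
    · linarith

/-- Modulo `α + β`, the steps `-α` and `β` agree. -/
theorem coe_greedyWalk_add (N n : ℕ) :
    ((greedyWalk α β u (N + n) : ℝ) : AddCircle (α + β)) =
      (greedyWalk α β u N : ℝ) + n • (β : AddCircle (α + β)) := by
  induction n with
  | zero => simp
  | succ n ih =>
    rw [← Nat.add_assoc, succ_nsmul, ← add_assoc, ← ih]
    rcases greedyWalk_succ_eq (α := α) (β := β) (u := u) (N + n) with h | h <;> rw [h]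
    · have : greedyWalk α β u (N + n) - α = greedyWalk α β u (N + n) + β - (α + β) := by ring
      rw [this, AddCircle.coe_sub, AddCircle.coe_period, sub_zero, AddCircle.coe_add]
    · rw [AddCircle.coe_add]

theorem exists_lt_greedyWalk (hα : 0 < α) (hβ : 0 < β) (hirr : Irrational (β / (α + β)))
    (hu : u ≤ 0) {c : ℝ} (hc : c < 0) : ∃ n, c < greedyWalk α β u n := by
  have hp : 0 < α + β := add_pos hα hβ
  have : Fact (0 < α + β) := ⟨hp⟩
  obtain ⟨N, hN⟩ := exists_forall_ge_lt_greedyWalk (u := u) hα hβ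
  have hdense : DenseRange (fun n : ℕ => n • (β : AddCircle (α + β))) :=
    denseRange_zsmul_iff_nsmul.1 (AddCircle.denseRange_zsmul_coe_iff.2 hirr)
  have hopen : IsOpen ((fun r : ℝ => (r : AddCircle (α + β))) '' Set.Ioo (max c (-(α + β))) 0) :=
    QuotientAddGroup.isOpenMap_coe _ isOpen_Ioo
  have hne : (Set.Ioo (max c (-(α + β))) 0).Nonempty :=
    Set.nonempty_Ioo.2 (max_lt hc (by linarith))
  obtain ⟨n, hn⟩ := hdense.exists_mem_open
    (hopen.preimage (continuous_const_add ((greedyWalk α β u N : ℝ) : AddCircle (α + β))))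
    (by
      obtain ⟨r, hr⟩ := hne
      exact ⟨(r : AddCircle (α + β)) - (greedyWalk α β u N : ℝ), r, hr, (add_sub_cancel _ _).symm⟩)
  obtain ⟨r, hr, hrn⟩ := hn
  refine ⟨N + n, ?_⟩
  replace hrn := hrn.trans (coe_greedyWalk_add N n).symm
  have h1 := hN n
  have h2 := greedyWalk_nonpos (β := β) hα hu (N + n)
  have h3 := (le_max_right _ _).trans_lt hr.1
  -- Both numbers lie in the fundamental domain `(-(α + β), 0]`, so equality on the circle lifts to
  -- `ℝ`.
  have : r = greedyWalk α β u (N + n) := by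
    refine (AddCircle.coe_eq_coe_iff_of_mem_Ioc (p := α + β) (a := -(α + β)) ⟨h3, ?_⟩
      ⟨h1, ?_⟩).1 hrn
    · linarith [hr.2]
    · linarith
  rw [← this]
  exact (le_max_left _ _).trans_lt hr.1

theorem NeverConnect.irrational {a b : ℝ} (h : NeverConnect a b) :
    Irrational (Real.log b / (-Real.log a + Real.log b)) := by
  obtain ⟨ha0, ha1, hb, hab⟩ := h
  have hα : 0 < -Real.log a := neg_pos.2 (Real.log_neg ha0 ha1)
  have hβ : 0 < Real.log b := Real.log_pos hb
  rintro ⟨q, hq⟩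
  rw [eq_div_iff (by linarith), Rat.cast_def, div_mul_eq_mul_div,
    div_eq_iff (by exact_mod_cast q.den_ne_zero)] at hq
  have hb0 : 0 < b := zero_lt_one.trans hb
  -- Clearing denominators in `log b / (log b - log a) = q` gives this relation, which would force
  -- `q.den = 0`.
  have hpow : a ^ (-q.num) = b ^ ((q.den : ℤ) - q.num) := by
    refine Real.log_injOn_pos (zpow_pos ha0 _) (zpow_pos hb0 _) ?_
    rw [Real.log_zpow, Real.log_zpow]
    push_cast
    linarith
  have := (hab _ _).1 hpow
  have hden : q.den ≠ 0 := q.den_ne_zero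
  omega

/-- From every starting point in `(0,1]` there is a walk in `(0,1]` with steps `a` and `b` and
supremum `1`. -/
theorem NeverConnect.exists_walk {a b s : ℝ} (h : NeverConnect a b) (hs0 : 0 < s) (hs1 : s ≤ 1) :
    ∃ g : ℕ → ℝ, g 0 = s ∧ (∀ n, 0 < g n) ∧ (∀ n, g n ≤ 1) ∧
      (∀ n, g (n + 1) = a * g n ∨ g (n + 1) = b * g n) ∧ ∀ c < 1, ∃ n, c < g n := by
  have hirr := h.irrational
  obtain ⟨ha0, ha1, hb, hab⟩ := h
  have hα : 0 < -Real.log a := neg_pos.2 (Real.log_neg ha0 ha1)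
  have hβ : 0 < Real.log b := Real.log_pos hb
  have hb0 : 0 < b := zero_lt_one.trans hb
  have hu : Real.log s ≤ 0 := Real.log_nonpos hs0.le hs1
  refine ⟨fun n => Real.exp (greedyWalk (-Real.log a) (Real.log b) (Real.log s) n),
    Real.exp_log hs0, fun n => Real.exp_pos _, fun n => ?_, fun n => ?_, fun c hc => ?_⟩
  · exact Real.exp_le_one_iff.2 (greedyWalk_nonpos hα hu n)
  · refine (greedyWalk_succ_eq (α := -Real.log a) (β := Real.log b) (u := Real.log s) n).imp
      (fun e => ?_) fun e => ?_
    · change Real.exp _ = _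
      rw [e, sub_neg_eq_add, Real.exp_add, Real.exp_log ha0, mul_comm]
    · change Real.exp _ = _
      rw [e, Real.exp_add, Real.exp_log hb0, mul_comm]
  · by_cases hc0 : c ≤ 0
    · exact ⟨0, hc0.trans_lt (Real.exp_pos _)⟩
    · push Not at hc0
      obtain ⟨n, hn⟩ := exists_lt_greedyWalk hα hβ hirr hu (Real.log_neg hc0 hc)
      exact ⟨n, (Real.log_lt_iff_lt_exp hc0).1 hn⟩

end GreedyWalk

/-! ### Mahavier products of unions of lines through the origin -/

section LineRelation

variable {Ω : Set ℝ}

theorem mem_twoSidedMahavier_lineRelation {x : ℤ → unitInterval} :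
    x ∈ twoSidedMahavier (lineRelation Ω) ↔ ∀ i, ∃ ω ∈ Ω, (x (i + 1) : ℝ) = ω * x i := by
  simp [twoSidedMahavier, lineRelation]

theorem exists_coord_succ (x : twoSidedMahavier (lineRelation Ω)) (i : ℤ) :
    ∃ ω ∈ Ω, (x.1 (i + 1) : ℝ) = ω * x.1 i :=
  mem_twoSidedMahavier_lineRelation.1 x.2 i

/-- Coordinatewise scaling. -/
instance : MulAction unitInterval (twoSidedMahavier (lineRelation Ω)) where
  smul t x := ⟨fun i => t * x.1 i, mem_twoSidedMahavier_lineRelation.2 fun i => by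
    obtain ⟨ω, hω, h⟩ := exists_coord_succ x i
    exact ⟨ω, hω, by
      change (t : ℝ) * x.1 (i + 1) = ω * (t * x.1 i)
      rw [h]
      ring⟩⟩
  one_smul x := Subtype.ext (funext fun i => one_mul (x.1 i))
  mul_smul s t x := Subtype.ext (funext fun i => mul_assoc s t (x.1 i))

theorem coord_smul (t : unitInterval) (x : twoSidedMahavier (lineRelation Ω)) (i : ℤ) :
    (((t • x).1 i : unitInterval) : ℝ) = t * x.1 i := rfl

instance : ContinuousSMul unitInterval (twoSidedMahavier (lineRelation Ω)) where
  continuous_smul := by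
    refine Continuous.subtype_mk (continuous_pi fun i => ?_) _
    exact continuous_fst.mul ((continuous_apply i).comp (continuous_subtype_val.comp continuous_snd))

theorem continuous_coord (i : ℤ) :
    Continuous fun x : twoSidedMahavier (lineRelation Ω) => (x.1 i : ℝ) :=
  continuous_subtype_val.comp ((continuous_apply i).comp continuous_subtype_val)

theorem isClosed_twoSidedMahavier_lineRelation (hfin : Ω.Finite) :
    IsClosed (twoSidedMahavier (lineRelation Ω)) := by
  have : twoSidedMahavier (lineRelation Ω) =
      ⋂ i : ℤ, ⋃ ω ∈ Ω, {x : ℤ → unitInterval | (x (i + 1) : ℝ) = ω * x i} := by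
    ext x
    simp [mem_twoSidedMahavier_lineRelation]
  rw [this]
  exact isClosed_iInter fun i => hfin.isClosed_biUnion fun ω _ =>
    isClosed_eq (by fun_prop) (by fun_prop)

theorem coord_pos (hpos : ∀ ω ∈ Ω, 0 < ω) (x : twoSidedMahavier (lineRelation Ω)) {i : ℤ}
    (h : (0 : ℝ) < x.1 i) (j : ℤ) : (0 : ℝ) < x.1 j := by
  refine Int.inductionOn' j i h (fun k _ hk => ?_) fun k _ hk => ?_
  · obtain ⟨ω, hω, e⟩ := exists_coord_succ x k
    rw [e]
    exact mul_pos (hpos ω hω) hk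
  · obtain ⟨ω, hω, e⟩ := exists_coord_succ x (k - 1)
    rw [sub_add_cancel] at e
    rw [e] at hk
    exact pos_of_mul_pos_right hk (hpos ω hω).le

/-- The constant sequence `0`. -/
def zeroPoint (hne : Ω.Nonempty) : twoSidedMahavier (lineRelation Ω) :=
  ⟨fun _ => 0, mem_twoSidedMahavier_lineRelation.2 fun _ => ⟨hne.some, hne.some_mem, by simp⟩⟩

theorem coord_pos_of_ne (hpos : ∀ ω ∈ Ω, 0 < ω) {hne : Ω.Nonempty}
    {x : twoSidedMahavier (lineRelation Ω)} (hx : x ≠ zeroPoint hne) (i : ℤ) :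
    (0 : ℝ) < x.1 i := by
  by_contra H
  refine hx (Subtype.ext (funext fun j => Subtype.ext ?_))
  by_contra hj
  exact H (coord_pos hpos x (lt_of_le_of_ne (x.1 j).2.1 (Ne.symm hj)) i)

theorem ne_zeroPoint {hne : Ω.Nonempty} {x : twoSidedMahavier (lineRelation Ω)} {i : ℤ}
    (h : (0 : ℝ) < x.1 i) : x ≠ zeroPoint hne := by
  rintro rfl
  exact lt_irrefl _ h

/-- A point lies on the ray of another one if it has the same ratios of successive coordinates
and is not larger at one index. -/
theorem mem_ray_of_ratio_eq (hpos : ∀ ω ∈ Ω, 0 < ω) {x z : twoSidedMahavier (lineRelation Ω)}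
    (hx : (0 : ℝ) < x.1 0) (hle : (z.1 0 : ℝ) ≤ x.1 0)
    (h : ∀ i, (z.1 (i + 1) : ℝ) * x.1 i = x.1 (i + 1) * z.1 i) : z ∈ ray x := by
  refine ⟨⟨(z.1 0 : ℝ) / x.1 0, div_nonneg (z.1 0).2.1 hx.le, (div_le_one hx).2 hle⟩, ?_⟩
  refine Subtype.ext (funext fun i => Subtype.ext ?_)
  rw [coord_smul]
  set t : ℝ := (z.1 0 : ℝ) / x.1 0 with ht
  have hxp := coord_pos hpos x hx
  refine Int.inductionOn' i 0 ?_ (fun k _ hk => ?_) fun k _ hk => ?_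
  · exact div_mul_cancel₀ _ hx.ne'
  · refine mul_right_cancel₀ (hxp k).ne' ?_
    rw [h k, ← hk]
    ring
  · have hk' := h (k - 1)
    rw [sub_add_cancel, ← hk] at hk'
    refine mul_left_cancel₀ (hxp k).ne' ?_
    rw [← hk']
    ring

theorem ratio_eq_of_mem_ray {x z : twoSidedMahavier (lineRelation Ω)} (h : z ∈ ray x) (i : ℤ) :
    (z.1 (i + 1) : ℝ) * x.1 i = x.1 (i + 1) * z.1 i := by
  obtain ⟨t, rfl⟩ := h
  simp only [coord_smul]
  ring

/-- Both `x` and `y` inherit the ratios of `z`, so their coordinates at `0` decide which is lower.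
-/
theorem mem_ray_or_mem_ray (hpos : ∀ ω ∈ Ω, 0 < ω) {hne : Ω.Nonempty}
    {x y z : twoSidedMahavier (lineRelation Ω)} (hzx : z ∈ ray x) (hzy : z ∈ ray y)
    (hz : z ≠ zeroPoint hne) : x ∈ ray y ∨ y ∈ ray x := by
  have hzp := coord_pos_of_ne hpos hz
  have key : ∀ w, z ∈ ray w → (0 : ℝ) < w.1 0 := by
    rintro w ⟨t, rfl⟩
    have := hzp 0
    rw [coord_smul] at this
    exact pos_of_mul_pos_right this t.2.1
  have ratio : ∀ i, (x.1 (i + 1) : ℝ) * y.1 i = y.1 (i + 1) * x.1 i := fun i => by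
    have h1 := ratio_eq_of_mem_ray hzx i
    have h2 := ratio_eq_of_mem_ray hzy i
    refine mul_left_cancel₀ (hzp i).ne' ?_
    linear_combination (-(y.1 i : ℝ)) * h1 + (x.1 i : ℝ) * h2
  rcases le_total (x.1 0 : ℝ) (y.1 0) with hle | hle
  · exact .inl (mem_ray_of_ratio_eq hpos (key y hzy) hle ratio)
  · exact .inr (mem_ray_of_ratio_eq hpos (key x hzx) hle fun i => (ratio i).symm)

theorem exists_forall_abs_le_mem {O : Set (twoSidedMahavier (lineRelation Ω))} (hO : IsOpen O)
    {z : twoSidedMahavier (lineRelation Ω)} (hz : z ∈ O) :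
    ∃ N : ℕ, ∀ w : twoSidedMahavier (lineRelation Ω),
      (∀ i : ℤ, i.natAbs ≤ N → (w.1 i : ℝ) = z.1 i) → w ∈ O := by
  obtain ⟨V, hV, rfl⟩ := isOpen_induced_iff.1 hO
  obtain ⟨F, u, hu, hsub⟩ := isOpen_pi_iff.1 hV z.1 hz
  refine ⟨F.sup Int.natAbs, fun w hw => hsub fun i hi => ?_⟩
  rw [show w.1 i = z.1 i from Subtype.ext (hw i (Finset.le_sup (f := Int.natAbs) hi))]
  exact (hu i hi).2

theorem coord_eq_of_ratio_eq (hpos : ∀ ω ∈ Ω, 0 < ω) {z w : twoSidedMahavier (lineRelation Ω)}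
    (hz : (0 : ℝ) < z.1 0) (h0 : (w.1 0 : ℝ) = z.1 0) {N : ℕ}
    (h : ∀ i : ℤ, i.natAbs ≤ N → (w.1 (i + 1) : ℝ) * z.1 i = z.1 (i + 1) * w.1 i) (i : ℤ)
    (hi : i.natAbs ≤ N) : (w.1 i : ℝ) = z.1 i := by
  have hzp := coord_pos hpos z hz
  revert hi
  refine Int.inductionOn' i 0 (fun _ => h0) (fun k hk0 hk hkN => ?_) fun k hk0 hk hkN => ?_
  · have h1 := h k (by omega)
    rw [hk (by omega)] at h1
    exact mul_right_cancel₀ (hzp k).ne' h1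
  · have h1 := h (k - 1) (by omega)
    rw [sub_add_cancel, hk (by omega)] at h1
    exact (mul_left_cancel₀ (hzp k).ne' h1).symm

/-- If `z ∉ K`, the points of `K` above level `z.1 0` with the ratios of `z` on a long window form a
relatively clopen subset of `K` containing `x` but not `y`. -/
theorem mem_of_isPreconnected (hfin : Ω.Finite) (hpos : ∀ ω ∈ Ω, 0 < ω) (hne : Ω.Nonempty)
    {K : Set (twoSidedMahavier (lineRelation Ω))} (hK : IsClosed K) (hc : IsPreconnected K)
    {x y z : twoSidedMahavier (lineRelation Ω)} (hx : x ∈ K) (hy : y ∈ K) (hzx : z ∈ ray x)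
    (hzy : z ∉ ray y) : z ∈ K := by
  by_contra hz
  have hzv : z ≠ zeroPoint hne := by
    rintro rfl
    exact hzy ⟨0, Subtype.ext (funext fun i => zero_mul _)⟩
  have hzp := coord_pos_of_ne hpos hzv
  obtain ⟨N₁, hN₁⟩ := exists_forall_abs_le_mem hK.isOpen_compl (z := z) hz
  -- The window must force closeness to `z` and, unless `y` is already below `z` at `0`, contain an
  -- index where the ratios of `y` and `z` differ.
  obtain ⟨N, hNN, hyN⟩ : ∃ N, N₁ ≤ N ∧ ((z.1 0 : ℝ) ≤ y.1 0 →
      ¬ ∀ i : ℤ, i.natAbs ≤ N → (y.1 (i + 1) : ℝ) * z.1 i = z.1 (i + 1) * y.1 i) := by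
    by_cases hle : (z.1 0 : ℝ) ≤ y.1 0
    · obtain ⟨i, hi⟩ : ∃ i : ℤ, (z.1 (i + 1) : ℝ) * y.1 i ≠ y.1 (i + 1) * z.1 i := by
        by_contra! H
        exact hzy (mem_ray_of_ratio_eq hpos ((hzp 0).trans_le hle) hle H)
      refine ⟨max N₁ i.natAbs, le_max_left _ _, fun _ H => hi ?_⟩
      linear_combination -(H i (le_max_right _ _))
    · exact ⟨N₁, le_rfl, fun h => absurd h hle⟩
  -- `U` excludes the finitely many wrong slopes, an open condition; `C` requires the right ratios,
  -- a closed one. On `K` they agree, as a point of `C` at the level of `z` would be in the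
  -- neighbourhood of `z` missing `K`.
  let U : Set (twoSidedMahavier (lineRelation Ω)) := {w | (z.1 0 : ℝ) < w.1 0} ∩
    ⋂ i ∈ Set.Icc (-N : ℤ) N, ⋂ ω ∈ {ω ∈ Ω | ω * (z.1 i : ℝ) ≠ z.1 (i + 1)},
      {w | (w.1 (i + 1) : ℝ) ≠ ω * w.1 i}
  let C : Set (twoSidedMahavier (lineRelation Ω)) := {w | (z.1 0 : ℝ) ≤ w.1 0} ∩
    ⋂ i : ℤ, ⋂ _ : i.natAbs ≤ N, {w | (w.1 (i + 1) : ℝ) * z.1 i = z.1 (i + 1) * w.1 i}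
  have memC : ∀ w, w ∈ C ↔ (z.1 0 : ℝ) ≤ w.1 0 ∧
      ∀ i : ℤ, i.natAbs ≤ N → (w.1 (i + 1) : ℝ) * z.1 i = z.1 (i + 1) * w.1 i := fun w => by
    simp [C]
  have hU : IsOpen U := by
    refine (isOpen_lt continuous_const (continuous_coord 0)).inter ?_
    refine (Set.finite_Icc _ _).isOpen_biInter fun i _ =>
      (hfin.subset (Set.sep_subset _ _)).isOpen_biInter fun ω _ => ?_
    exact isOpen_ne_fun (continuous_coord _) (continuous_const.mul (continuous_coord _))
  have hC : IsClosed C := by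
    refine (isClosed_le continuous_const (continuous_coord 0)).inter ?_
    refine isClosed_iInter fun i => isClosed_iInter fun _ => ?_
    exact isClosed_eq ((continuous_coord _).mul continuous_const)
      (continuous_const.mul (continuous_coord _))
  have hUC : U ⊆ C := by
    rintro w ⟨hw0, hw⟩
    refine (memC w).2 ⟨hw0.le, fun i hi => ?_⟩
    obtain ⟨ω, hω, e⟩ := exists_coord_succ w i
    by_cases hωz : ω * (z.1 i : ℝ) = z.1 (i + 1)
    · rw [e, ← hωz]
      ring
    · refine absurd e ?_
      simp only [Set.mem_iInter] at hw
      exact hw i ⟨by omega, by omega⟩ ω ⟨hω, hωz⟩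
  have hCU : K ∩ C ⊆ U := by
    rintro w ⟨hwK, hw⟩
    obtain ⟨hw0, hw⟩ := (memC w).1 hw
    have hlt : (z.1 0 : ℝ) < w.1 0 := by
      refine lt_of_le_of_ne hw0 fun e => ?_
      exact hN₁ w (fun i hi => coord_eq_of_ratio_eq hpos (hzp 0) e.symm hw i (hi.trans hNN)) hwK
    refine ⟨hlt, ?_⟩
    simp only [Set.mem_iInter]
    rintro i ⟨hi1, hi2⟩ ω ⟨hω, hωz⟩ e
    refine hωz (mul_right_cancel₀ (coord_pos hpos w ((hzp 0).trans hlt) i).ne' ?_)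
    rw [← hw i (by omega), e]
    ring
  have hxC : x ∈ C := by
    refine (memC x).2 ⟨?_, fun i _ => ?_⟩
    · obtain ⟨t, rfl⟩ := hzx
      exact mul_le_of_le_one_left (x.1 0).2.1 t.2.2
    · linear_combination -(ratio_eq_of_mem_ray hzx i)
  have hyC : y ∉ C := fun h => hyN ((memC y).1 h).1 ((memC y).1 h).2
  obtain ⟨w, -, hwU, hwC⟩ := hc U Cᶜ hU hC.isOpen_compl
    (fun w hw => (em (w ∈ C)).imp (fun h => hCU ⟨hw, h⟩) id)
    ⟨x, hx, hCU ⟨hx, hxC⟩⟩ ⟨y, hy, hyC⟩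
  exact hwC (hUC hwU)

theorem isStarAction_twoSidedMahavier (hfin : Ω.Finite) (hpos : ∀ ω ∈ Ω, 0 < ω)
    (hne : Ω.Nonempty) :
    IsStarAction (twoSidedMahavier (lineRelation Ω)) (zeroPoint hne) where
  zero_smul x := Subtype.ext (funext fun i => zero_mul _)
  smul_inj x s t hx h := by
    have h0 : (s : ℝ) * x.1 0 = t * x.1 0 :=
      congrArg (fun w : twoSidedMahavier (lineRelation Ω) => (w.1 0 : ℝ)) h
    exact Subtype.ext (mul_right_cancel₀ (coord_pos_of_ne hpos hx 0).ne' h0)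
  comparable _ _ _ := mem_ray_or_mem_ray hpos
  cut _ hK hc _ hx _ hy _ hzx hzy := mem_of_isPreconnected hfin hpos hne hK hc hx hy hzx hzy

/-- The point of the Mahavier product with a maximum at index `k` which grows by the factor `b`
before `k` and by the factor `a` after `k`. -/
noncomputable def peak {a b : ℝ} (ha : a ∈ Ω) (hb : b ∈ Ω) (ha0 : 0 < a) (ha1 : a < 1)
    (hb1 : 1 < b) (k : ℤ) : twoSidedMahavier (lineRelation Ω) :=
  ⟨fun i => if h : i ≤ k
      then ⟨b ^ (i - k), (zpow_pos (zero_lt_one.trans hb1) _).le,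
        zpow_le_one_of_nonpos₀ hb1.le (by omega)⟩
      else ⟨a ^ (i - k), (zpow_pos ha0 _).le, by
        simpa using zpow_right_anti₀ ha0 ha1.le (show (0 : ℤ) ≤ i - k by omega)⟩,
    mem_twoSidedMahavier_lineRelation.2 fun i => by
      rcases lt_trichotomy i k with h | h | h
      · refine ⟨b, hb, ?_⟩
        rw [dif_pos (show i + 1 ≤ k by omega), dif_pos h.le]
        change b ^ (i + 1 - k) = b * b ^ (i - k)
        rw [← zpow_one_add₀ (zero_lt_one.trans hb1).ne']
        congr 1
        ring
      · subst h
        refine ⟨a, ha, ?_⟩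
        simp
      · refine ⟨a, ha, ?_⟩
        rw [dif_neg (show ¬ i + 1 ≤ k by omega), dif_neg (show ¬ i ≤ k by omega)]
        change a ^ (i + 1 - k) = a * a ^ (i - k)
        rw [← zpow_one_add₀ ha0.ne']
        congr 1
        ring⟩

section Peak

variable {a b : ℝ} (ha : a ∈ Ω) (hb : b ∈ Ω) (ha0 : 0 < a) (ha1 : a < 1) (hb1 : 1 < b)

theorem peak_coord_of_le {i k : ℤ} (h : i ≤ k) :
    ((peak ha hb ha0 ha1 hb1 k).1 i : ℝ) = b ^ (i - k) := by
  simp [peak, h]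

theorem peak_coord_succ (k : ℤ) : ((peak ha hb ha0 ha1 hb1 k).1 (k + 1) : ℝ) = a := by
  simp [peak]

theorem peak_ne_zeroPoint (hne : Ω.Nonempty) (k : ℤ) :
    peak ha hb ha0 ha1 hb1 k ≠ zeroPoint hne :=
  ne_zeroPoint (i := k) (by
    rw [peak_coord_of_le ha hb ha0 ha1 hb1 le_rfl]
    exact zpow_pos (zero_lt_one.trans hb1) _)

/-- From `k` to `k + 1` the first peak has ratio `a` and the second still has ratio `b`. -/
theorem ray_peak_inter (hpos : ∀ ω ∈ Ω, 0 < ω) (hne : Ω.Nonempty) {k l : ℤ} (hkl : k < l) :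
    ray (peak ha hb ha0 ha1 hb1 k) ∩ ray (peak ha hb ha0 ha1 hb1 l) = {zeroPoint hne} := by
  have hb0 : 0 < b := zero_lt_one.trans hb1
  ext z
  constructor
  · rintro ⟨hzk, hzl⟩
    by_contra hz
    have hzp := coord_pos_of_ne hpos hz k
    have h1 := ratio_eq_of_mem_ray hzk k
    have h2 := ratio_eq_of_mem_ray hzl k
    rw [peak_coord_succ, peak_coord_of_le _ _ _ _ _ le_rfl, sub_self, zpow_zero, mul_one] at h1
    rw [peak_coord_of_le _ _ _ _ _ hkl.le, peak_coord_of_le _ _ _ _ _ (by omega : k + 1 ≤ l), h1,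
      show k + 1 - l = 1 + (k - l) by ring, zpow_one_add₀ hb0.ne'] at h2
    have h3 : a = b := by
      refine mul_right_cancel₀ (mul_pos hzp (zpow_pos hb0 (k - l))).ne' ?_
      linear_combination h2
    linarith
  · rintro rfl
    exact ⟨⟨0, Subtype.ext (funext fun i => zero_mul _)⟩,
      ⟨0, Subtype.ext (funext fun i => zero_mul _)⟩⟩

end Peak

/-- Every point other than `0` can be modified far to the right so that its supremum becomes
`1`. -/
theorem exists_maximal_eqOn (hpos : ∀ ω ∈ Ω, 0 < ω) {a b : ℝ} (hab : NeverConnect a b) (ha : a ∈ Ω)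
    (hb : b ∈ Ω) {x : twoSidedMahavier (lineRelation Ω)} (hx : (0 : ℝ) < x.1 0) (N : ℤ) :
    ∃ y : twoSidedMahavier (lineRelation Ω), (∀ i ≤ N, (y.1 i : ℝ) = x.1 i) ∧
      ∀ w, y ∈ ray w → w = y := by
  obtain ⟨g, g0, gpos, g1, gstep, gsup⟩ :=
    hab.exists_walk (coord_pos hpos x hx N) (x.1 N).2.2
  -- The two pieces match at `N` because `g 0 = x.1 N`.
  let f : ℤ → unitInterval := fun i =>
    if i ≤ N then x.1 i else ⟨g (i - N).toNat, (gpos _).le, g1 _⟩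
  have hf : ∀ n : ℕ, (f (N + n) : ℝ) = g n := by
    intro n
    rcases n with - | n
    · simp [f, g0]
    · simp only [f]
      rw [if_neg (by push_cast; omega)]
      simp
  have hfx : ∀ i ≤ N, f i = x.1 i := fun i hi => if_pos hi
  have hmem : f ∈ twoSidedMahavier (lineRelation Ω) := by
    refine mem_twoSidedMahavier_lineRelation.2 fun i => ?_
    rcases lt_or_ge i N with hi | hi
    · rw [hfx i hi.le, hfx (i + 1) hi]
      exact exists_coord_succ x i
    · obtain ⟨n, rfl⟩ : ∃ n : ℕ, i = N + n := ⟨(i - N).toNat, by omega⟩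
      have h1 : (f (N + n + 1) : ℝ) = g (n + 1) := by
        rw [← hf]
        push_cast
        rw [add_assoc]
      rw [hf, h1]
      rcases gstep n with e | e
      · exact ⟨a, ha, e⟩
      · exact ⟨b, hb, e⟩
  refine ⟨⟨f, hmem⟩, fun i hi => congrArg Subtype.val (hfx i hi), ?_⟩
  rintro w ⟨t, ht⟩
  have htop : t = 1 := by
    by_contra hne
    have hlt : (t : ℝ) < 1 := lt_of_le_of_ne t.2.2 fun e => hne (Subtype.ext e)
    -- All coordinates of `t • w` are at most `t`, whereas the walk exceeds `t`.
    obtain ⟨n, hn⟩ := gsup t hlt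
    have h1 : (t : ℝ) * w.1 (N + n) = f (N + n) :=
      congrArg (fun w : twoSidedMahavier (lineRelation Ω) => (w.1 (N + n) : ℝ)) ht
    rw [hf] at h1
    have h2 : (t : ℝ) * w.1 (N + n) ≤ t := mul_le_of_le_one_right t.2.1 (w.1 (N + n)).2.2
    linarith
  rw [← ht, htop]
  exact (one_smul _ w).symm

theorem dense_maximal (hpos : ∀ ω ∈ Ω, 0 < ω) (hne : Ω.Nonempty) {a b : ℝ}
    (hab : NeverConnect a b) (ha : a ∈ Ω) (hb : b ∈ Ω) :
    Dense {x : twoSidedMahavier (lineRelation Ω) |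
      x ≠ zeroPoint hne ∧ ∀ y, x ∈ ray y → y = x} := by
  have hsub : {x | x ≠ zeroPoint hne} ⊆ closure {x : twoSidedMahavier (lineRelation Ω) |
      x ≠ zeroPoint hne ∧ ∀ y, x ∈ ray y → y = x} := by
    intro x hx
    have hxp := coord_pos_of_ne hpos hx
    rw [mem_closure_iff]
    intro O hO hxO
    obtain ⟨N, hN⟩ := exists_forall_abs_le_mem hO hxO
    obtain ⟨y, hyx, hy⟩ := exists_maximal_eqOn hpos hab ha hb (hxp 0) N
    refine ⟨y, hN y fun i hi => hyx i (by omega), ne_zeroPoint (i := 0) ?_, hy⟩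
    rw [hyx 0 (by omega)]
    exact hxp 0
  -- The zero sequence is the limit of `t • p` as `t → 0`, for any nonzero `p`.
  have hz : zeroPoint hne ∈ closure {x : twoSidedMahavier (lineRelation Ω) |
      x ≠ zeroPoint hne} := by
    let p := peak ha hb hab.1 hab.2.1 hab.2.2.1 0
    have hcont : Continuous fun t : unitInterval => t • p := by fun_prop
    have hp : (0 : ℝ) < p.1 0 :=
      coord_pos_of_ne hpos (peak_ne_zeroPoint ha hb hab.1 hab.2.1 hab.2.2.1 hne 0) 0
    have h0 : (0 : unitInterval) ∈ closure (Set.Ioi (0 : unitInterval)) := by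
      rw [closure_Ioi' ⟨1, zero_lt_one⟩]
      exact Set.self_mem_Ici
    have h1 := map_mem_closure hcont h0 (t := {x | x ≠ zeroPoint hne}) fun t ht =>
      ne_zeroPoint (i := 0) (mul_pos ht hp)
    have h2 : (0 : unitInterval) • p = zeroPoint hne := Subtype.ext (funext fun i => zero_mul _)
    rwa [h2] at h1
  intro x
  by_cases hx : x = zeroPoint hne
  · rw [hx]
    exact closure_minimal hsub isClosed_closure hz
  · exact hsub hx

end LineRelation

theorem mainTheorem3 (Ω : Set ℝ) (hΩ : IsLFInducing Ω) :
    IsLelekFan (twoSidedMahavier (lineRelation Ω)) := by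
  obtain ⟨M, hM, ω, rfl, hω, hab⟩ := hΩ
  have hpos : ∀ r ∈ Set.range ω, 0 < r := by
    rintro _ ⟨i, rfl⟩
    exact hω i
  have hfin : (Set.range ω).Finite := Set.finite_range ω
  have ha : ω ⟨0, by omega⟩ ∈ Set.range ω := Set.mem_range_self _
  have hb : ω ⟨1, by omega⟩ ∈ Set.range ω := Set.mem_range_self _
  have hne : (Set.range ω).Nonempty := ⟨_, ha⟩
  have : CompactSpace (twoSidedMahavier (lineRelation (Set.range ω))) :=
    isCompact_iff_compactSpace.1 (isClosed_twoSidedMahavier_lineRelation hfin).isCompact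
  have inter : ∀ k l : ℤ, k < l → _ := fun k l hkl =>
    ray_peak_inter ha hb hab.1 hab.2.1 hab.2.2.1 hpos hne hkl
  have ne := peak_ne_zeroPoint ha hb hab.1 hab.2.1 hab.2.2.1 hne
  exact (isStarAction_twoSidedMahavier hfin hpos hne).isLelekFan (inter 0 1 (by norm_num))
    (inter 1 2 (by norm_num)) (inter 0 2 (by norm_num)) (ne 0) (ne 1) (ne 2)
    (dense_maximal hpos hne hab ha hb)
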